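/- For a positive integer $n$ let $F(n)=\#\{b\in(\mathbb Z/n\mathbb Z)^\times : b^{n-1}=1\}$, let $\varphi$ be Euler's function, and for $n>1$ let $P^+(n)$ denote the largest prime factor of $n$. For composite $n$ put $P=P^+(n)$ and $Q=P^+(n/P)$ (the two largest prime factors of $n$, counted with multiplicity). Let $x,L_1,L,M$ be real numbers with $10<L_1<L<M/2$ and $x>L^2>M$. Then $$\sum_{\substack{n\le x,\ n\text{ odd, composite}\\ P\le L,\ PQ>M\\ F(n)\ge\varphi(n)/L_1}}F(n)\ \le\ x^2C,$$ where $$C=\frac{L^2}{2x}(1+\log L_1)+\frac{2(1+\log L_1)^2}{M\log M}+\frac{1}{12(M-2L)}(1+\log L)(4+\log L_1)^4\Big(\frac{5}{12}+(\zeta(3)-1)(1+\log L)\Big)$$ and $\zeta$ is the Riemann zeta-function. -/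

import Mathlib

/-- The number of residues `b` in `(ℤ/nℤ)ˣ` with `b ^ (n - 1) = 1`. -/
noncomputable def fermatCount (n : ℕ) : ℕ :=
  Nat.card {b : (ZMod n)ˣ // b ^ (n - 1) = 1}

/-- The largest prime factor of `n`, for `n > 1` (the value is `0` for `n ≤ 1`). -/
def largestPrimeFactor (n : ℕ) : ℕ :=
  n.primeFactors.sup id

/-- The second largest prime factor of `n`, counted with multiplicity, for composite `n`. -/
def secondPrimeFactor (n : ℕ) : ℕ :=
  largestPrimeFactor (n / largestPrimeFactor n)

open scoped Classical in
/-- The odd composite `n ≤ x` whose two largest prime factors `P ≥ Q` satisfy `P ≤ L` and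
`P * Q > M`, and for which `F(n) ≥ φ(n) / L₁`. -/
noncomputable def smoothNearCarmichael (x L₁ L M : ℝ) : Finset ℕ :=
  (Finset.Icc 1 ⌊x⌋₊).filter fun n =>
    Odd n ∧ 1 < n ∧ ¬ n.Prime ∧
    (largestPrimeFactor n : ℝ) ≤ L ∧
    M < (largestPrimeFactor n : ℝ) * (secondPrimeFactor n : ℝ) ∧
    (Nat.totient n : ℝ) / L₁ ≤ (fermatCount n : ℝ)

/-- The constant `C`; `ζ(3)` is real and is written as the real part of the complex value. -/
noncomputable def constC (x L₁ L M : ℝ) : ℝ :=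
  L ^ 2 / (2 * x) * (1 + Real.log L₁)
    + 2 * (1 + Real.log L₁) ^ 2 / (M * Real.log M)
    + 1 / (12 * (M - 2 * L)) * (1 + Real.log L) * (4 + Real.log L₁) ^ 4
      * (5 / 12 + ((riemannZeta 3).re - 1) * (1 + Real.log L))

/-!
The exponent `n - 1` cuts out a subgroup of index `φ(n) / F(n)` in the units modulo `n`. Projecting
the units onto those modulo a divisor of `n` bounds this index from below: it is at least `p` if
`p ^ 2 ∣ n`, and at least `d₁ * d₂` if `p * q ∣ n` for distinct primes `p` and `q`, where
`p - 1 = d₁ * g₁` with `g₁ = gcd(p - 1, n - 1)`, and `q - 1 = d₂ * g₂` likewise.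

If `P = Q`, then `F(n) ≤ x / √M` and the number of `n` belonging to `P` is at most `x / P ^ 2`.
If `P ≠ Q`, then `F(n) ≤ x / (d₁ * d₂)`, and `F(n) ≥ φ(n) / L₁` forces `d₁ * d₂ ≤ L₁`. The
quadruple `(d₁, d₂, g₁, g₂)` determines `P` and `Q`, and the `n` belonging to it satisfy
`n ≡ 0` modulo `P * Q` and `n ≡ 1` modulo `lcm(g₁, g₂)`, so there are at most
`1 + x / (P * Q * lcm(g₁, g₂))` of them. Summing over the quadruples, the `1` gives the term of `C`
with `L ^ 2` and the main part the term with `M - 2 * L`, since `(P - 1) * (Q - 1) > M - 2 * L`;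
the latter has room for the contribution `2 * x ^ 2 / M` of the case `P = Q`, because
`144 * (1 + log L₁) ^ 2 ≤ (4 + log L₁) ^ 4` and `ζ(3) - 1 ≥ 1 / 6`.
-/

open Finset Real

/-! ### Finite sums -/

theorem sum_le_sum_of_injOn {ι κ N : Type*} [AddCommMonoid N] [PartialOrder N]
    [IsOrderedAddMonoid N] {s : Finset ι} {t : Finset κ} {f : ι → N} {g : κ → N} (i : ι → κ)
    (hi : ∀ a ∈ s, i a ∈ t) (hinj : Set.InjOn i s) (hfg : ∀ a ∈ s, f a ≤ g (i a))
    (hg : ∀ b ∈ t, 0 ≤ g b) : ∑ a ∈ s, f a ≤ ∑ b ∈ t, g b := by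
  classical
  calc ∑ a ∈ s, f a ≤ ∑ a ∈ s, g (i a) := sum_le_sum hfg
    _ = ∑ b ∈ s.image i, g b := (sum_image hinj).symm
    _ ≤ ∑ b ∈ t, g b :=
      sum_le_sum_of_subset_of_nonneg (image_subset_iff.mpr hi) fun b hb _ => hg b hb

theorem sum_le_sum_mul_of_card_fiber_le {ι κ R : Type*} [DecidableEq κ] [Semiring R]
    [PartialOrder R] [IsOrderedRing R] {s : Finset ι} {t : Finset κ} {f : ι → R} {c b : κ → R}
    (i : ι → κ) (hi : ∀ a ∈ s, i a ∈ t) (hf : ∀ a ∈ s, f a ≤ c (i a)) (hc : ∀ k ∈ t, 0 ≤ c k)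
    (hb : ∀ k ∈ t, (#{a ∈ s | i a = k} : R) ≤ b k) : ∑ a ∈ s, f a ≤ ∑ k ∈ t, c k * b k := by
  rw [← sum_fiberwise_of_maps_to hi]
  refine sum_le_sum fun k hk => ?_
  calc ∑ a ∈ s with i a = k, f a ≤ ∑ a ∈ s with i a = k, c k := by
        refine sum_le_sum fun a ha => ?_
        obtain ⟨has, rfl⟩ := mem_filter.mp ha
        exact hf a has
    _ = c k * #{a ∈ s | i a = k} := by rw [sum_const, nsmul_eq_mul, Nat.cast_comm]
    _ ≤ c k * b k := mul_le_mul_of_nonneg_left (hb k hk) (hc k hk)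

theorem two_mul_sum_filter_lt_le {ι κ R : Type*} [LinearOrder κ] [Semiring R] [PartialOrder R]
    [IsOrderedAddMonoid R] {s : Finset ι} {w : ι → R} {σ : ι → ι}
    (hσ : Function.Involutive σ) (hs : ∀ z ∈ s, σ z ∈ s) (hwσ : ∀ z, w (σ z) = w z)
    (hw : ∀ z ∈ s, 0 ≤ w z) (f : ι → κ) :
    2 * ∑ z ∈ s with f (σ z) < f z, w z ≤ ∑ z ∈ s, w z := by
  classical
  have hswap : ∑ z ∈ s with f z < f (σ z), w z = ∑ z ∈ s with f (σ z) < f z, w z :=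
    sum_nbij' σ σ (by simp +contextual [hs, hσ _]) (by simp +contextual [hs, hσ _])
      (by simp [hσ _]) (by simp [hσ _]) (by simp [hwσ])
  have hdisj : Disjoint {z ∈ s | f (σ z) < f z} {z ∈ s | f z < f (σ z)} :=
    disjoint_filter.mpr fun z _ => lt_asymm
  calc 2 * ∑ z ∈ s with f (σ z) < f z, w z
      = ∑ z ∈ {z ∈ s | f (σ z) < f z} ∪ {z ∈ s | f z < f (σ z)}, w z := by
        rw [sum_union hdisj, hswap, two_mul]
    _ ≤ ∑ z ∈ s, w z :=
        sum_le_sum_of_subset_of_nonneg (union_subset (filter_subset _ _) (filter_subset _ _))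
          fun z hz _ => hw z hz

theorem sum_inv_sq_le_two_div {s : Finset ℕ} {y : ℝ} (hy : 0 < y) (hs : ∀ a ∈ s, y < a) :
    ∑ a ∈ s, ((a : ℝ) ^ 2)⁻¹ ≤ 2 / y := by
  have hsub : s ⊆ Ioo ⌊y⌋₊ (s.sup id + 1) := fun a ha =>
    mem_Ioo.mpr ⟨(Nat.floor_lt hy.le).mpr (hs a ha), Nat.lt_succ_of_le (le_sup (f := id) ha)⟩
  calc ∑ a ∈ s, ((a : ℝ) ^ 2)⁻¹ ≤ ∑ a ∈ Ioo ⌊y⌋₊ (s.sup id + 1), ((a : ℝ) ^ 2)⁻¹ :=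
        sum_le_sum_of_subset_of_nonneg hsub fun _ _ _ => by positivity
    _ ≤ 2 / ((⌊y⌋₊ : ℝ) + 1) := sum_Ioo_inv_sq_le _ _
    _ ≤ 2 / y := by gcongr; exact (Nat.lt_floor_add_one y).le

theorem sum_inv_le_one_add_log {y : ℝ} (hy : 1 ≤ y) :
    ∑ a ∈ Icc 1 ⌊y⌋₊, (a : ℝ)⁻¹ ≤ 1 + log y := by
  simpa [harmonic_eq_sum_Icc] using harmonic_floor_le_one_add_log y hy

/-! ### Lattice points under hyperbolas -/

/-- The lattice points `(a, b)` with `a, b ≥ 1` and `a * b ≤ D`, that is, those under the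
hyperbola `a * b = D`. -/
def hyperbolaPairs (D : ℕ) : Finset (ℕ × ℕ) :=
  {d ∈ Icc 1 D ×ˢ Icc 1 D | d.1 * d.2 ≤ D}

theorem mem_hyperbolaPairs {D : ℕ} {d : ℕ × ℕ} :
    d ∈ hyperbolaPairs D ↔ 0 < d.1 ∧ 0 < d.2 ∧ d.1 * d.2 ≤ D := by
  simp only [hyperbolaPairs, mem_filter, mem_product, mem_Icc]
  constructor
  · rintro ⟨⟨⟨h₁, -⟩, h₂, -⟩, h⟩
    exact ⟨h₁, h₂, h⟩
  · rintro ⟨h₁, h₂, h⟩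
    exact ⟨⟨⟨h₁, (Nat.le_mul_of_pos_right _ h₂).trans h⟩, h₂,
      (Nat.le_mul_of_pos_left _ h₁).trans h⟩, h⟩

-- The number of pairs with product `m` is `τ(m) ≤ m`.
theorem sum_hyperbolaPairs_inv_sq_le (D : ℕ) :
    ∑ d ∈ hyperbolaPairs D, (((d.1 * d.2 : ℕ) : ℝ) ^ 2)⁻¹ ≤ ∑ m ∈ Icc 1 D, (m : ℝ)⁻¹ := by
  have hcard (m : ℕ) : #{d ∈ hyperbolaPairs D | d.1 * d.2 = m} ≤ m := by
    refine (card_le_card (t := m.divisorsAntidiagonal) fun d hd => ?_).trans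
      ((Nat.card_divisors_le_self m).trans' ?_)
    · obtain ⟨hdD, rfl⟩ := mem_filter.mp hd
      obtain ⟨h₁, h₂, -⟩ := mem_hyperbolaPairs.mp hdD
      exact Nat.mem_divisorsAntidiagonal.mpr ⟨rfl, (Nat.mul_pos h₁ h₂).ne'⟩
    · rw [← Nat.map_div_right_divisors, card_map]
  calc ∑ d ∈ hyperbolaPairs D, (((d.1 * d.2 : ℕ) : ℝ) ^ 2)⁻¹
      ≤ ∑ m ∈ Icc 1 D, ((m : ℝ) ^ 2)⁻¹ * m := by
        refine sum_le_sum_mul_of_card_fiber_le (fun d : ℕ × ℕ => d.1 * d.2) (fun d hd => ?_)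
          (fun _ _ => le_rfl) (fun _ _ => by positivity) fun m _ => by exact_mod_cast hcard m
        obtain ⟨h₁, h₂, h⟩ := mem_hyperbolaPairs.mp hd
        exact mem_Icc.mpr ⟨Nat.mul_pos h₁ h₂, h⟩
    _ = ∑ m ∈ Icc 1 D, (m : ℝ)⁻¹ := by
        refine sum_congr rfl fun m hm => ?_
        have : (m : ℝ) ≠ 0 := by exact_mod_cast Nat.one_le_iff_ne_zero.mp (mem_Icc.mp hm).1
        field_simp

theorem sum_inv_cube_mul_sq_mul_sq_le (E : ℕ) {K : ℝ} (hK : 0 < K) :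
    ∑ y ∈ (Icc 1 E ×ˢ Icc 1 E) ×ˢ Icc 1 E with K < ((y.1.1 ^ 2 * y.1.2 * y.2 : ℕ) : ℝ),
        ((y.1.1 ^ 3 * y.1.2 ^ 2 * y.2 ^ 2 : ℕ) : ℝ)⁻¹ ≤
      2 / K * (∑ m ∈ Icc 1 E, (m : ℝ)⁻¹) ^ 2 := by
  rw [sum_finset_product _ (Icc 1 E ×ˢ Icc 1 E)
    (fun v => {a ∈ Icc 1 E | K < ((v.1 ^ 2 * v.2 * a : ℕ) : ℝ)}) (by simp [and_assoc])]
  calc _ ≤ ∑ v ∈ Icc 1 E ×ˢ Icc 1 E, 2 / K * ((v.1 : ℝ)⁻¹ * (v.2 : ℝ)⁻¹) := by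
        refine sum_le_sum fun v hv => ?_
        obtain ⟨hu, hb⟩ := mem_product.mp hv
        have hu : (0 : ℝ) < v.1 := by exact_mod_cast (mem_Icc.mp hu).1
        have hb : (0 : ℝ) < v.2 := by exact_mod_cast (mem_Icc.mp hb).1
        have htail : ∑ a ∈ Icc 1 E with K < ((v.1 ^ 2 * v.2 * a : ℕ) : ℝ), ((a : ℝ) ^ 2)⁻¹ ≤
            2 / (K / (v.1 ^ 2 * v.2)) :=
          sum_inv_sq_le_two_div (by positivity) fun a ha => by
            rw [div_lt_iff₀' (by positivity)]
            exact_mod_cast (mem_filter.mp ha).2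
        calc _ = ((v.1 : ℝ) ^ 3 * (v.2 : ℝ) ^ 2)⁻¹ *
              ∑ a ∈ Icc 1 E with K < ((v.1 ^ 2 * v.2 * a : ℕ) : ℝ), ((a : ℝ) ^ 2)⁻¹ := by
              rw [mul_sum]
              exact sum_congr rfl fun a _ => by push_cast; rw [mul_inv]
          _ ≤ ((v.1 : ℝ) ^ 3 * (v.2 : ℝ) ^ 2)⁻¹ * (2 / (K / (v.1 ^ 2 * v.2))) := by gcongr
          _ = 2 / K * ((v.1 : ℝ)⁻¹ * (v.2 : ℝ)⁻¹) := by field_simp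
    _ = 2 / K * (∑ m ∈ Icc 1 E, (m : ℝ)⁻¹) ^ 2 := by
        rw [← mul_sum, sq, sum_mul_sum, ← sum_product']

-- With `u = gcd g₁ g₂`, `g₁ = u * a` and `g₂ = u * b`, the summand is `u⁻³ * b⁻² * a⁻²`.
theorem sum_inv_mul_lcm_le (E : ℕ) {K : ℝ} (hK : 0 < K) :
    ∑ g ∈ Icc 1 E ×ˢ Icc 1 E with K < ((g.1 * g.2 : ℕ) : ℝ),
        ((g.1 * g.2 * g.1.lcm g.2 : ℕ) : ℝ)⁻¹ ≤
      2 / K * (∑ m ∈ Icc 1 E, (m : ℝ)⁻¹) ^ 2 := by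
  let i (g : ℕ × ℕ) : (ℕ × ℕ) × ℕ :=
    ((g.1.gcd g.2, g.2 / g.1.gcd g.2), g.1 / g.1.gcd g.2)
  have hfst (g : ℕ × ℕ) : g.1 = (i g).1.1 * (i g).2 :=
    (Nat.mul_div_cancel' (Nat.gcd_dvd_left _ _)).symm
  have hsnd (g : ℕ × ℕ) : g.2 = (i g).1.1 * (i g).1.2 :=
    (Nat.mul_div_cancel' (Nat.gcd_dvd_right _ _)).symm
  have hlcm (g : ℕ × ℕ) : g.1.lcm g.2 = (i g).1.1 * (i g).2 * (i g).1.2 := by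
    rw [← hfst]; exact Nat.mul_div_assoc _ (Nat.gcd_dvd_right _ _)
  refine (sum_le_sum_of_injOn i (fun g hg => ?_) (fun g _ g' _ h => ?_) (fun g _ => ?_)
    fun _ _ => by positivity).trans (sum_inv_cube_mul_sq_mul_sq_le E hK)
  · obtain ⟨hgE, hgK⟩ := mem_filter.mp hg
    simp only [mem_product, mem_Icc] at hgE
    obtain ⟨⟨h₁, h₁E⟩, h₂, h₂E⟩ := hgE
    have hu : 0 < g.1.gcd g.2 := Nat.gcd_pos_of_pos_left _ h₁
    refine mem_filter.mpr ⟨?_, ?_⟩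
    · simp only [i, mem_product, mem_Icc]
      exact ⟨⟨⟨hu, (Nat.gcd_le_left _ h₁).trans h₁E⟩,
        Nat.div_pos (Nat.gcd_le_right _ h₂) hu, (Nat.div_le_self _ _).trans h₂E⟩,
        Nat.div_pos (Nat.gcd_le_left _ h₁) hu, (Nat.div_le_self _ _).trans h₁E⟩
    · rwa [show (i g).1.1 ^ 2 * (i g).1.2 * (i g).2 = g.1 * g.2 by rw [hfst g, hsnd g]; ring]
  · exact Prod.ext (by rw [hfst g, hfst g', h]) (by rw [hsnd g, hsnd g', h])
  · rw [show (i g).1.1 ^ 3 * (i g).1.2 ^ 2 * (i g).2 ^ 2 = g.1 * g.2 * g.1.lcm g.2 by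
      rw [hlcm g, hfst g, hsnd g]; ring]

/-! ### The Fermat count -/

theorem index_powMonoidHom_ker_dvd_of_surjective {G H : Type*} [CommGroup G] [CommGroup H]
    (f : G →* H) (hf : Function.Surjective f) (k : ℕ) :
    (powMonoidHom k : H →* H).ker.index ∣ (powMonoidHom k : G →* G).ker.index := by
  rw [← Subgroup.index_comap_of_surjective _ hf]
  refine Subgroup.index_dvd_of_le fun g hg => ?_
  rw [MonoidHom.mem_ker, powMonoidHom_apply] at hg
  rw [Subgroup.mem_comap, MonoidHom.mem_ker, powMonoidHom_apply, ← map_pow, hg, map_one]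

theorem index_powMonoidHom_ker_prod (G H : Type*) [CommGroup G] [CommGroup H] (k : ℕ) :
    (powMonoidHom k : G × H →* G × H).ker.index =
      (powMonoidHom k : G →* G).ker.index * (powMonoidHom k : H →* H).ker.index := by
  rw [← Subgroup.index_prod]
  exact congrArg Subgroup.index
    (MonoidHom.ker_prodMap (powMonoidHom k : G →* G) (powMonoidHom k : H →* H))

theorem card_units_zmod (n : ℕ) [NeZero n] : Nat.card (ZMod n)ˣ = n.totient := by
  rw [Nat.card_eq_fintype_card, ZMod.card_units_eq_totient]

theorem fermatCount_mul_index (n : ℕ) [NeZero n] :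
    fermatCount n * (powMonoidHom (n - 1) : (ZMod n)ˣ →* (ZMod n)ˣ).ker.index = n.totient := by
  rw [← card_units_zmod, ← Subgroup.card_mul_index (powMonoidHom (n - 1) : (ZMod n)ˣ →* _).ker]
  rfl

theorem fermatCount_mul_index_dvd_totient {n : ℕ} [NeZero n] {H : Type*} [CommGroup H]
    (f : (ZMod n)ˣ →* H) (hf : Function.Surjective f) :
    fermatCount n * (powMonoidHom (n - 1) : H →* H).ker.index ∣ n.totient := by
  rw [← fermatCount_mul_index n]
  exact mul_dvd_mul_left _ (index_powMonoidHom_ker_dvd_of_surjective f hf _)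

/-- The number `g = gcd(p - 1, n - 1)`; for a prime `p` it counts the solutions of
`b ^ (n - 1) = 1` modulo `p`. -/
def fermatGcd (n p : ℕ) : ℕ :=
  (p - 1).gcd (n - 1)

/-- The cofactor `d = (p - 1) / g` of `g = fermatGcd n p`; for a prime `p` it is the index in
`(ℤ/pℤ)ˣ` of the subgroup `b ^ (n - 1) = 1`. -/
def fermatCofactor (n p : ℕ) : ℕ :=
  (p - 1) / fermatGcd n p

theorem fermatCofactor_mul_fermatGcd (n p : ℕ) : fermatCofactor n p * fermatGcd n p = p - 1 :=
  Nat.div_mul_cancel (Nat.gcd_dvd_left _ _)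

theorem fermatGcd_dvd_sub_one (n p : ℕ) : fermatGcd n p ∣ n - 1 :=
  Nat.gcd_dvd_right _ _

theorem fermatGcd_pos {p : ℕ} (hp : 1 < p) (n : ℕ) : 0 < fermatGcd n p :=
  Nat.gcd_pos_of_pos_left _ (Nat.sub_pos_of_lt hp)

theorem fermatCofactor_pos {p : ℕ} (hp : 1 < p) (n : ℕ) : 0 < fermatCofactor n p :=
  Nat.div_pos (Nat.gcd_le_left _ (Nat.sub_pos_of_lt hp)) (fermatGcd_pos hp n)

theorem index_powMonoidHom_ker_units_zmod_prime (n : ℕ) {p : ℕ} (hp : p.Prime) :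
    (powMonoidHom (n - 1) : (ZMod p)ˣ →* (ZMod p)ˣ).ker.index = fermatCofactor n p := by
  have : Fact p.Prime := ⟨hp⟩
  rw [IsCyclic.index_powMonoidHom_ker, card_units_zmod, Nat.totient_prime hp, fermatCofactor,
    fermatGcd]

theorem isCyclic_units_zmod_prime_sq {p : ℕ} (hp : p.Prime) : IsCyclic (ZMod (p ^ 2))ˣ := by
  rcases eq_or_ne p 2 with rfl | hp2
  · exact ZMod.isCyclic_units_four
  · exact ZMod.isCyclic_units_of_prime_pow p hp hp2 2

theorem fermatCount_mul_cofactors_dvd_totient {n p q : ℕ} [NeZero n] (hp : p.Prime)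
    (hq : q.Prime) (hpq : p ≠ q) (hn : p * q ∣ n) :
    fermatCount n * (fermatCofactor n p * fermatCofactor n q) ∣ n.totient := by
  let e : (ZMod (p * q))ˣ ≃* (ZMod p)ˣ × (ZMod q)ˣ :=
    (Units.mapEquiv
      (ZMod.chineseRemainder ((Nat.coprime_primes hp hq).mpr hpq)).toMulEquiv).trans
      MulEquiv.prodUnits
  have h := fermatCount_mul_index_dvd_totient (e.toMonoidHom.comp (ZMod.unitsMap hn))
    (e.surjective.comp (ZMod.unitsMap_surjective hn))
  rwa [index_powMonoidHom_ker_prod, index_powMonoidHom_ker_units_zmod_prime n hp,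
    index_powMonoidHom_ker_units_zmod_prime n hq] at h

theorem fermatCount_mul_prime_dvd_totient {n p : ℕ} [NeZero n] (hp : p.Prime)
    (hn : p ^ 2 ∣ n) : fermatCount n * p ∣ n.totient := by
  have : NeZero (p ^ 2) := ⟨pow_ne_zero 2 hp.ne_zero⟩
  have := isCyclic_units_zmod_prime_sq hp
  have hcop : p.Coprime (n - 1) :=
    Nat.Coprime.coprime_dvd_left ((dvd_pow_self p two_ne_zero).trans hn)
      ((Nat.coprime_self_sub_right (NeZero.one_le)).mpr (Nat.coprime_one_right n))
  have hindex : (powMonoidHom (n - 1) : (ZMod (p ^ 2))ˣ →* (ZMod (p ^ 2))ˣ).ker.index =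
      p * fermatCofactor n p := by
    rw [IsCyclic.index_powMonoidHom_ker, card_units_zmod, Nat.totient_prime_pow hp two_pos,
      show p ^ (2 - 1) = p from pow_one p, hcop.gcd_mul_left_cancel,
      Nat.mul_div_assoc _ (Nat.gcd_dvd_left _ _), fermatCofactor, fermatGcd]
  have h := fermatCount_mul_index_dvd_totient _ (ZMod.unitsMap_surjective hn)
  rw [hindex] at h
  exact (mul_dvd_mul_left _ (dvd_mul_right _ _)).trans h

theorem fermatCount_pos (n : ℕ) [NeZero n] : 0 < fermatCount n :=
  Nat.pos_of_mul_pos_right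
    ((fermatCount_mul_index n).symm ▸ Nat.totient_pos.mpr (NeZero.pos n))

/-! ### Counting in residue classes -/

theorem card_filter_dvd_and_dvd_sub_one_le (X m l : ℕ) :
    #{n ∈ Icc 1 X | m ∣ n ∧ l ∣ n - 1} ≤ X / (m * l) + 1 := by
  rw [← card_range (X / (m * l) + 1)]
  refine card_le_card_of_injOn (· / (m * l)) (fun n hn => ?_) fun a ha b hb hab => ?_
  · have hnX := (mem_Icc.mp (mem_filter.mp hn).1).2
    simpa [Nat.lt_succ_iff] using Nat.div_le_div_right hnX
  · obtain ⟨haX, hma, hla⟩ := mem_filter.mp ha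
    obtain ⟨hbX, hmb, hlb⟩ := mem_filter.mp hb
    have ha₁ := (mem_Icc.mp haX).1
    have hb₁ := (mem_Icc.mp hbX).1
    have hcop : m.Coprime l := Nat.Coprime.of_dvd hma hla
      ((Nat.coprime_self_sub_right ha₁).mpr (Nat.coprime_one_right a))
    have hmod : a ≡ b [MOD m * l] := (Nat.modEq_and_modEq_iff_modEq_mul hcop).mp
      ⟨(Nat.modEq_zero_iff_dvd.mpr hma).trans (Nat.modEq_zero_iff_dvd.mpr hmb).symm,
        ((Nat.modEq_iff_dvd' ha₁).mpr hla).symm.trans ((Nat.modEq_iff_dvd' hb₁).mpr hlb)⟩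
    rw [← Nat.div_add_mod a (m * l), ← Nat.div_add_mod b (m * l), show a % (m * l) = _ from hmod]
    exact congrArg (m * l * · + _) hab

theorem card_filter_floor_dvd_le {x : ℝ} (hx : 0 ≤ x) (m : ℕ) :
    (#{n ∈ Ioc 0 ⌊x⌋₊ | m ∣ n} : ℝ) ≤ x / m := by
  rw [Nat.Ioc_filter_dvd_card_eq_div]
  exact Nat.cast_div_le.trans (by gcongr; exact Nat.floor_le hx)

/-! ### Integers with a large square factor -/

theorem fermatCount_le_div_of_mul_dvd_totient {x : ℝ} {n k : ℕ} (hn : n ≠ 0) (hnx : (n : ℝ) ≤ x)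
    (h : fermatCount n * k ∣ n.totient) : (fermatCount n : ℝ) ≤ x / k := by
  have hφ : 0 < n.totient := Nat.totient_pos.mpr (Nat.pos_of_ne_zero hn)
  have hk : 0 < k := Nat.pos_of_dvd_of_pos ((dvd_mul_left _ _).trans h) hφ
  rw [le_div_iff₀ (by exact_mod_cast hk)]
  calc (fermatCount n : ℝ) * k ≤ n.totient := by exact_mod_cast Nat.le_of_dvd hφ h
    _ ≤ n := by exact_mod_cast Nat.totient_le n
    _ ≤ x := hnx

theorem sum_fermatCount_of_prime_sq_dvd_le {x M : ℝ} (hx : 0 ≤ x) (hM : 0 < M) {s : Finset ℕ}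
    (hs : ∀ n ∈ s, n ≠ 0 ∧ (n : ℝ) ≤ x ∧ ∃ p : ℕ, p.Prime ∧ M < (p : ℝ) ^ 2 ∧ p ^ 2 ∣ n) :
    ∑ n ∈ s, (fermatCount n : ℝ) ≤ x ^ 2 * (2 / M) := by
  choose! hn₀ hnx P hP hMP hdvd using hs
  have hsqrt : 0 < √M := sqrt_pos.mpr hM
  have hsqrtP : ∀ n ∈ s, √M < P n := fun n hn =>
    (sqrt_lt' (by exact_mod_cast (hP n hn).pos)).mpr (hMP n hn)
  have hbound : ∀ n ∈ s, (fermatCount n : ℝ) ≤ x / √M := fun n hn => by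
    have : NeZero n := ⟨hn₀ n hn⟩
    refine (fermatCount_le_div_of_mul_dvd_totient (hn₀ n hn) (hnx n hn)
      (fermatCount_mul_prime_dvd_totient (hP n hn) (hdvd n hn))).trans ?_
    gcongr
    exact (hsqrtP n hn).le
  have hcard : ∀ p ∈ s.image P, (#{n ∈ s | P n = p} : ℝ) ≤ x * ((p : ℝ) ^ 2)⁻¹ := fun p _ => by
    rw [← div_eq_mul_inv]
    refine le_trans ?_ ((card_filter_floor_dvd_le hx (p ^ 2)).trans_eq (by push_cast; rfl))
    refine Nat.cast_le.mpr (card_le_card fun n hn => ?_)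
    obtain ⟨hns, rfl⟩ := mem_filter.mp hn
    exact mem_filter.mpr ⟨mem_Ioc.mpr ⟨Nat.pos_of_ne_zero (hn₀ n hns), Nat.le_floor (hnx n hns)⟩,
      hdvd n hns⟩
  calc ∑ n ∈ s, (fermatCount n : ℝ) ≤ ∑ p ∈ s.image P, x / √M * (x * ((p : ℝ) ^ 2)⁻¹) :=
        sum_le_sum_mul_of_card_fiber_le P (fun n hn => mem_image_of_mem P hn) hbound
          (fun _ _ => by positivity) hcard
    _ = x / √M * (x * ∑ p ∈ s.image P, ((p : ℝ) ^ 2)⁻¹) := by rw [← mul_sum, ← mul_sum]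
    _ ≤ x / √M * (x * (2 / √M)) := by
        gcongr
        exact sum_inv_sq_le_two_div hsqrt (forall_mem_image.mpr hsqrtP)
    _ = x ^ 2 * (2 / √M ^ 2) := by ring
    _ = x ^ 2 * (2 / M) := by rw [sq_sqrt hM.le]

/-! ### Integers with two large prime factors -/

/-- The quadruples `((d₁, d₂), (g₁, g₂))` of positive integers with `d₁ * d₂ ≤ D`, `d₁ * g₁ ≤ E`
and `d₂ * g₂ ≤ E`. They record the factorizations `p - 1 = d₁ * g₁` and `q - 1 = d₂ * g₂` for two
primes `p` and `q`. -/
def factorQuadruples (D E : ℕ) : Finset ((ℕ × ℕ) × (ℕ × ℕ)) :=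
  {z ∈ hyperbolaPairs D ×ˢ Icc 1 E ×ˢ Icc 1 E | z.1.1 * z.2.1 ≤ E ∧ z.1.2 * z.2.2 ≤ E}

theorem mem_factorQuadruples {D E : ℕ} {z : (ℕ × ℕ) × (ℕ × ℕ)} :
    z ∈ factorQuadruples D E ↔ z.1 ∈ hyperbolaPairs D ∧
      (0 < z.2.1 ∧ z.1.1 * z.2.1 ≤ E) ∧ (0 < z.2.2 ∧ z.1.2 * z.2.2 ≤ E) := by
  simp only [factorQuadruples, mem_filter, mem_product, mem_Icc]
  constructor
  · rintro ⟨⟨hd, ⟨h₁, -⟩, h₂, -⟩, hE₁, hE₂⟩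
    exact ⟨hd, ⟨h₁, hE₁⟩, h₂, hE₂⟩
  · rintro ⟨hd, ⟨h₁, hE₁⟩, h₂, hE₂⟩
    obtain ⟨hd₁, hd₂, -⟩ := mem_hyperbolaPairs.mp hd
    exact ⟨⟨hd, ⟨h₁, (Nat.le_mul_of_pos_left _ hd₁).trans hE₁⟩, h₂,
      (Nat.le_mul_of_pos_left _ hd₂).trans hE₂⟩, hE₁, hE₂⟩

theorem sum_factorQuadruples_inv_le (D E : ℕ) :
    ∑ z ∈ factorQuadruples D E, ((z.1.1 * z.1.2 : ℕ) : ℝ)⁻¹ ≤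
      E ^ 2 * ∑ m ∈ Icc 1 D, (m : ℝ)⁻¹ := by
  rw [sum_finset_product _ (hyperbolaPairs D) fun d => Icc 1 (E / d.1) ×ˢ Icc 1 (E / d.2)]
  · calc _ ≤ ∑ d ∈ hyperbolaPairs D, (E : ℝ) ^ 2 * (((d.1 * d.2 : ℕ) : ℝ) ^ 2)⁻¹ := by
          refine sum_le_sum fun d _ => ?_
          dsimp only
          rw [sum_const, nsmul_eq_mul, card_product, Nat.card_Icc, Nat.card_Icc]
          calc _ = ((E / d.1 : ℕ) : ℝ) * ((E / d.2 : ℕ) : ℝ) * ((d.1 * d.2 : ℕ) : ℝ)⁻¹ := by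
                push_cast [Nat.add_sub_cancel]; rfl
            _ ≤ ((E : ℝ) / d.1) * ((E : ℝ) / d.2) * ((d.1 * d.2 : ℕ) : ℝ)⁻¹ := by
                gcongr <;> exact Nat.cast_div_le
            _ = (E : ℝ) ^ 2 * (((d.1 * d.2 : ℕ) : ℝ) ^ 2)⁻¹ := by
                push_cast; ring
      _ ≤ (E : ℝ) ^ 2 * ∑ m ∈ Icc 1 D, (m : ℝ)⁻¹ := by
          rw [← mul_sum]
          exact mul_le_mul_of_nonneg_left (sum_hyperbolaPairs_inv_sq_le D) (by positivity)
  · intro z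
    rw [mem_factorQuadruples]
    refine and_congr_right fun hd => ?_
    obtain ⟨hd₁, hd₂, -⟩ := mem_hyperbolaPairs.mp hd
    simp only [mem_product, mem_Icc, Nat.le_div_iff_mul_le hd₁, Nat.le_div_iff_mul_le hd₂,
      Nat.succ_le_iff, mul_comm]

-- Swapping the two factorizations accounts for the factor `2`.
theorem two_mul_sum_factorQuadruples_inv_le (D E : ℕ) :
    2 * ∑ z ∈ factorQuadruples D E with z.1.2 * z.2.2 < z.1.1 * z.2.1,
        ((z.1.1 * z.1.2 : ℕ) : ℝ)⁻¹ ≤ E ^ 2 * ∑ m ∈ Icc 1 D, (m : ℝ)⁻¹ := by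
  let σ (z : (ℕ × ℕ) × (ℕ × ℕ)) : (ℕ × ℕ) × (ℕ × ℕ) := (z.1.swap, z.2.swap)
  have hσ : ∀ z ∈ factorQuadruples D E, σ z ∈ factorQuadruples D E := fun z hz => by
    obtain ⟨hd, h₁, h₂⟩ := mem_factorQuadruples.mp hz
    obtain ⟨hd₁, hd₂, hD⟩ := mem_hyperbolaPairs.mp hd
    exact mem_factorQuadruples.mpr
      ⟨mem_hyperbolaPairs.mpr ⟨hd₂, hd₁, (mul_comm _ _).trans_le hD⟩, h₂, h₁⟩
  have hw (z : (ℕ × ℕ) × (ℕ × ℕ)) :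
      (((σ z).1.1 * (σ z).1.2 : ℕ) : ℝ)⁻¹ = ((z.1.1 * z.1.2 : ℕ) : ℝ)⁻¹ := by
    rw [mul_comm z.1.1]; rfl
  exact (two_mul_sum_filter_lt_le (w := fun z => ((z.1.1 * z.1.2 : ℕ) : ℝ)⁻¹) (σ := σ)
    (fun _ => rfl) hσ hw (fun _ _ => by positivity) fun z => z.1.1 * z.2.1).trans
    (sum_factorQuadruples_inv_le D E)

theorem sum_inv_sq_mul_lcm_le (D E : ℕ) {N : ℝ} (hN : 0 < N) :
    ∑ z ∈ (Icc 1 D ×ˢ Icc 1 D) ×ˢ Icc 1 E ×ˢ Icc 1 E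
        with N < ((z.1.1 * z.2.1 * (z.1.2 * z.2.2) : ℕ) : ℝ),
        (((z.1.1 * z.1.2) ^ 2 * (z.2.1 * z.2.2 * z.2.1.lcm z.2.2) : ℕ) : ℝ)⁻¹ ≤
      2 / N * (∑ m ∈ Icc 1 D, (m : ℝ)⁻¹) ^ 2 * (∑ m ∈ Icc 1 E, (m : ℝ)⁻¹) ^ 2 := by
  set H := ∑ m ∈ Icc 1 E, (m : ℝ)⁻¹
  rw [sum_finset_product _ (Icc 1 D ×ˢ Icc 1 D) fun d =>
    {g ∈ Icc 1 E ×ˢ Icc 1 E | N < ((d.1 * g.1 * (d.2 * g.2) : ℕ) : ℝ)}]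
  · calc _ ≤ ∑ d ∈ Icc 1 D ×ˢ Icc 1 D, 2 / N * H ^ 2 * ((d.1 : ℝ)⁻¹ * (d.2 : ℝ)⁻¹) := by
          refine sum_le_sum fun d hd => ?_
          obtain ⟨h₁, h₂⟩ := mem_product.mp hd
          have h₁ : (0 : ℝ) < d.1 := by exact_mod_cast (mem_Icc.mp h₁).1
          have h₂ : (0 : ℝ) < d.2 := by exact_mod_cast (mem_Icc.mp h₂).1
          have hfilter : {g ∈ Icc 1 E ×ˢ Icc 1 E | N < ((d.1 * g.1 * (d.2 * g.2) : ℕ) : ℝ)} =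
              {g ∈ Icc 1 E ×ˢ Icc 1 E | N / (d.1 * d.2) < ((g.1 * g.2 : ℕ) : ℝ)} :=
            filter_congr fun g _ => by
              rw [div_lt_iff₀' (by positivity), mul_mul_mul_comm]; push_cast; rfl
          calc _ = ((d.1 * d.2 : ℝ) ^ 2)⁻¹ * ∑ g ∈ Icc 1 E ×ˢ Icc 1 E
                    with N / (d.1 * d.2) < ((g.1 * g.2 : ℕ) : ℝ),
                  ((g.1 * g.2 * g.1.lcm g.2 : ℕ) : ℝ)⁻¹ := by
                rw [hfilter, mul_sum]
                exact sum_congr rfl fun g _ => by push_cast; rw [mul_inv]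
            _ ≤ ((d.1 * d.2 : ℝ) ^ 2)⁻¹ * (2 / (N / (d.1 * d.2)) * H ^ 2) := by
                gcongr; exact sum_inv_mul_lcm_le E (by positivity)
            _ = 2 / N * H ^ 2 * ((d.1 : ℝ)⁻¹ * (d.2 : ℝ)⁻¹) := by field_simp
      _ = 2 / N * (∑ m ∈ Icc 1 D, (m : ℝ)⁻¹) ^ 2 * H ^ 2 := by
          rw [← mul_sum, sq (∑ m ∈ Icc 1 D, _), sum_mul_sum, ← sum_product', mul_right_comm]
  · intro z
    simp only [mem_filter, mem_product, and_assoc]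

/-- The factorizations `p - 1 = d₁ * g₁` and `q - 1 = d₂ * g₂`, with `g₁ = gcd(p - 1, n - 1)` and
`g₂ = gcd(q - 1, n - 1)`, as the quadruple `((d₁, d₂), (g₁, g₂))`. -/
def fermatQuadruple (n p q : ℕ) : (ℕ × ℕ) × (ℕ × ℕ) :=
  ((fermatCofactor n p, fermatCofactor n q), (fermatGcd n p, fermatGcd n q))

theorem cofactors_mul_le_of_totient_div_le {L₁ : ℝ} (hL₁ : 0 < L₁) {n p q : ℕ} (hn : n ≠ 0)
    (hp : p.Prime) (hq : q.Prime) (hpq : p ≠ q) (hdvd : p * q ∣ n)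
    (hF : (n.totient : ℝ) / L₁ ≤ fermatCount n) :
    ((fermatCofactor n p * fermatCofactor n q : ℕ) : ℝ) ≤ L₁ := by
  have : NeZero n := ⟨hn⟩
  have hF₀ : (0 : ℝ) < fermatCount n := by exact_mod_cast fermatCount_pos n
  have hle : fermatCount n * (fermatCofactor n p * fermatCofactor n q) ≤ n.totient :=
    Nat.le_of_dvd (Nat.totient_pos.mpr (Nat.pos_of_ne_zero hn))
      (fermatCount_mul_cofactors_dvd_totient hp hq hpq hdvd)
  refine le_of_mul_le_mul_left ?_ hF₀
  calc (fermatCount n : ℝ) * ((fermatCofactor n p * fermatCofactor n q : ℕ) : ℝ)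
      ≤ n.totient := by exact_mod_cast hle
    _ ≤ fermatCount n * L₁ := (div_le_iff₀ hL₁).mp hF

theorem fermatQuadruple_mem_factorQuadruples {n p q D E : ℕ} (hp : 1 < p) (hq : 1 < q)
    (hD : fermatCofactor n p * fermatCofactor n q ≤ D) (hpE : p ≤ E) (hqE : q ≤ E) :
    fermatQuadruple n p q ∈ factorQuadruples D E :=
  mem_factorQuadruples.mpr
    ⟨mem_hyperbolaPairs.mpr ⟨fermatCofactor_pos hp n, fermatCofactor_pos hq n, hD⟩,
      ⟨fermatGcd_pos hp n,
        (fermatCofactor_mul_fermatGcd n p).trans_le ((Nat.sub_le _ _).trans hpE)⟩,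
      fermatGcd_pos hq n,
      (fermatCofactor_mul_fermatGcd n q).trans_le ((Nat.sub_le _ _).trans hqE)⟩

theorem sub_lt_sub_one_mul_sub_one {L M : ℝ} {p q : ℕ} (hp : 1 ≤ p) (hq : 1 ≤ q)
    (hpL : (p : ℝ) ≤ L) (hqL : (q : ℝ) ≤ L) (hM : M < (p : ℝ) * q) :
    M - 2 * L < (((p - 1) * (q - 1) : ℕ) : ℝ) := by
  push_cast [hp, hq]
  linarith

theorem card_filter_fermatQuadruple_eq_le {x : ℝ} (hx : 0 ≤ x) {s : Finset ℕ} {P Q : ℕ → ℕ}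
    (hs : ∀ n ∈ s, n ≠ 0 ∧ (n : ℝ) ≤ x ∧ 0 < P n ∧ 0 < Q n ∧ P n * Q n ∣ n)
    {z : (ℕ × ℕ) × (ℕ × ℕ)}
    (hz : 0 < z.1.1 * z.2.1 * (z.1.2 * z.2.2) * z.2.1.lcm z.2.2) :
    (#{n ∈ s | fermatQuadruple n (P n) (Q n) = z} : ℝ) ≤
      1 + x * ((z.1.1 * z.2.1 * (z.1.2 * z.2.2) * z.2.1.lcm z.2.2 : ℕ) : ℝ)⁻¹ := by
  set p := z.1.1 * z.2.1 + 1
  set q := z.1.2 * z.2.2 + 1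
  set l := z.2.1.lcm z.2.2
  have hsub : {n ∈ s | fermatQuadruple n (P n) (Q n) = z} ⊆
      {n ∈ Icc 1 ⌊x⌋₊ | p * q ∣ n ∧ l ∣ n - 1} := fun n hn => by
    obtain ⟨hns, rfl⟩ := mem_filter.mp hn
    obtain ⟨hn₀, hnx, hP, hQ, hdvd⟩ := hs n hns
    have hp : p = P n := by
      rw [← Nat.sub_add_cancel hP, ← fermatCofactor_mul_fermatGcd n (P n)]; rfl
    have hq : q = Q n := by
      rw [← Nat.sub_add_cancel hQ, ← fermatCofactor_mul_fermatGcd n (Q n)]; rfl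
    exact mem_filter.mpr ⟨mem_Icc.mpr ⟨Nat.one_le_iff_ne_zero.mpr hn₀, Nat.le_floor hnx⟩,
      by rwa [hp, hq], Nat.lcm_dvd (fermatGcd_dvd_sub_one n _) (fermatGcd_dvd_sub_one n _)⟩
  have hcard := (card_le_card hsub).trans (card_filter_dvd_and_dvd_sub_one_le ⌊x⌋₊ (p * q) l)
  have hle : z.1.1 * z.2.1 * (z.1.2 * z.2.2) * l ≤ p * q * l := by
    gcongr <;> exact Nat.le_succ _
  calc _ ≤ ((⌊x⌋₊ / (p * q * l) : ℕ) : ℝ) + 1 := by exact_mod_cast hcard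
    _ ≤ (⌊x⌋₊ : ℝ) / (p * q * l : ℕ) + 1 := by gcongr; exact Nat.cast_div_le
    _ ≤ x / (z.1.1 * z.2.1 * (z.1.2 * z.2.2) * l : ℕ) + 1 := by
        gcongr
        exact Nat.floor_le hx
    _ = _ := by rw [div_eq_mul_inv, add_comm]

theorem sum_factorQuadruples_mul_le {x L₁ L N : ℝ} (hx : 0 ≤ x) (hL₁ : 1 ≤ L₁) (hL : 1 ≤ L)
    (hN : 0 < N) :
    ∑ z ∈ factorQuadruples ⌊L₁⌋₊ ⌊L⌋₊ with z.1.2 * z.2.2 < z.1.1 * z.2.1 ∧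
          N < ((z.1.1 * z.2.1 * (z.1.2 * z.2.2) : ℕ) : ℝ),
        x * ((z.1.1 * z.1.2 : ℕ) : ℝ)⁻¹ *
          (1 + x * ((z.1.1 * z.2.1 * (z.1.2 * z.2.2) * z.2.1.lcm z.2.2 : ℕ) : ℝ)⁻¹) ≤
      x * (L ^ 2 / 2 * (1 + log L₁)) + x ^ 2 * (2 / N * (1 + log L₁) ^ 2 * (1 + log L) ^ 2) := by
  set T := {z ∈ factorQuadruples ⌊L₁⌋₊ ⌊L⌋₊ | z.1.2 * z.2.2 < z.1.1 * z.2.1 ∧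
    N < ((z.1.1 * z.2.1 * (z.1.2 * z.2.2) : ℕ) : ℝ)}
  have hH₁ := sum_inv_le_one_add_log hL₁
  have hH := sum_inv_le_one_add_log hL
  have hleft : ∑ z ∈ T, ((z.1.1 * z.1.2 : ℕ) : ℝ)⁻¹ ≤ L ^ 2 / 2 * (1 + log L₁) := by
    have hfloor : (⌊L⌋₊ : ℝ) ^ 2 * ∑ m ∈ Icc 1 ⌊L₁⌋₊, (m : ℝ)⁻¹ ≤ L ^ 2 * (1 + log L₁) := by
      gcongr
      exact Nat.floor_le (by positivity)
    refine (sum_le_sum_of_subset_of_nonneg (monotone_filter_right _ fun z _ hz => hz.1)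
      fun _ _ _ => by positivity).trans ?_
    linarith [two_mul_sum_factorQuadruples_inv_le ⌊L₁⌋₊ ⌊L⌋₊]
  have hright : ∑ z ∈ T,
      (((z.1.1 * z.1.2) ^ 2 * (z.2.1 * z.2.2 * z.2.1.lcm z.2.2) : ℕ) : ℝ)⁻¹ ≤
      2 / N * (1 + log L₁) ^ 2 * (1 + log L) ^ 2 := by
    refine (sum_le_sum_of_subset_of_nonneg (fun z hz => ?_) fun _ _ _ => by positivity).trans
      ((sum_inv_sq_mul_lcm_le ⌊L₁⌋₊ ⌊L⌋₊ hN).trans (by gcongr))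
    obtain ⟨hzT, -, hzN⟩ := mem_filter.mp hz
    obtain ⟨hbox, hg⟩ := mem_product.mp (mem_filter.mp hzT).1
    exact mem_filter.mpr ⟨mem_product.mpr ⟨(mem_filter.mp hbox).1, hg⟩, hzN⟩
  calc _ = x * ∑ z ∈ T, ((z.1.1 * z.1.2 : ℕ) : ℝ)⁻¹ + x ^ 2 * ∑ z ∈ T,
          (((z.1.1 * z.1.2) ^ 2 * (z.2.1 * z.2.2 * z.2.1.lcm z.2.2) : ℕ) : ℝ)⁻¹ := by
        rw [mul_sum, mul_sum, ← sum_add_distrib]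
        refine sum_congr rfl fun z _ => ?_
        push_cast
        ring
    _ ≤ _ := by gcongr

theorem sum_fermatCount_of_primes_mul_dvd_le {x L₁ L M : ℝ} (hx : 0 ≤ x) (hL₁ : 1 ≤ L₁)
    (hL : 1 ≤ L) (hM : 2 * L < M) {s : Finset ℕ}
    (hs : ∀ n ∈ s, n ≠ 0 ∧ (n : ℝ) ≤ x ∧ (n.totient : ℝ) / L₁ ≤ fermatCount n ∧
      ∃ p q : ℕ, p.Prime ∧ q.Prime ∧ q < p ∧ (p : ℝ) ≤ L ∧ M < (p : ℝ) * q ∧ p * q ∣ n) :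
    ∑ n ∈ s, (fermatCount n : ℝ) ≤ x * (L ^ 2 / 2 * (1 + log L₁)) +
      x ^ 2 * (2 / (M - 2 * L) * (1 + log L₁) ^ 2 * (1 + log L) ^ 2) := by
  choose! hn₀ hnx hF P Q hP hQ hQP hPL hMPQ hdvd using hs
  refine (sum_le_sum_mul_of_card_fiber_le (fun n => fermatQuadruple n (P n) (Q n))
    (fun n hn => ?mem) (fun n hn => ?bound) (fun _ _ => by positivity) fun z hz => ?card).trans
    (sum_factorQuadruples_mul_le hx hL₁ hL (sub_pos.mpr hM))
  case mem =>
    have hQL : (Q n : ℝ) ≤ L := (Nat.cast_le.mpr (hQP n hn).le).trans (hPL n hn)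
    refine mem_filter.mpr ⟨fermatQuadruple_mem_factorQuadruples (hP n hn).one_lt (hQ n hn).one_lt
      (Nat.le_floor (cofactors_mul_le_of_totient_div_le (by positivity) (hn₀ n hn) (hP n hn)
        (hQ n hn) (hQP n hn).ne' (hdvd n hn) (hF n hn)))
      (Nat.le_floor (hPL n hn)) (Nat.le_floor hQL), ?_⟩
    simp only [fermatQuadruple, fermatCofactor_mul_fermatGcd]
    exact ⟨Nat.sub_lt_sub_right (hQ n hn).one_le (hQP n hn), sub_lt_sub_one_mul_sub_one
      (hP n hn).one_le (hQ n hn).one_le (hPL n hn) hQL (hMPQ n hn)⟩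
  case bound =>
    have : NeZero n := ⟨hn₀ n hn⟩
    rw [← div_eq_mul_inv]
    exact fermatCount_le_div_of_mul_dvd_totient (hn₀ n hn) (hnx n hn)
      (fermatCount_mul_cofactors_dvd_totient (hP n hn) (hQ n hn) (hQP n hn).ne' (hdvd n hn))
  case card =>
    obtain ⟨hd, ⟨hg₁, -⟩, hg₂, -⟩ := mem_factorQuadruples.mp (mem_filter.mp hz).1
    obtain ⟨hd₁, hd₂, -⟩ := mem_hyperbolaPairs.mp hd
    exact card_filter_fermatQuadruple_eq_le hx
      (fun n hn => ⟨hn₀ n hn, hnx n hn, (hP n hn).pos, (hQ n hn).pos, hdvd n hn⟩)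
      (Nat.mul_pos (Nat.mul_pos (Nat.mul_pos hd₁ hg₁) (Nat.mul_pos hd₂ hg₂))
        (Nat.lcm_pos hg₁ hg₂))

/-! ### The constant -/

theorem one_sixth_le_zeta_three_sub_one : 1 / 6 ≤ (riemannZeta 3).re - 1 := by
  have hsum : Summable fun n : ℕ => 1 / (n : ℝ) ^ 3 :=
    summable_one_div_nat_pow.mpr (by norm_num)
  have hzeta : riemannZeta 3 = ((∑' n : ℕ, 1 / (n : ℝ) ^ 3 : ℝ) : ℂ) := by
    push_cast
    exact_mod_cast zeta_nat_eq_tsum_of_gt_one (k := 3) (by norm_num)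
  have hpartial : ∑ n ∈ range 5, 1 / (n : ℝ) ^ 3 ≤ ∑' n : ℕ, 1 / (n : ℝ) ^ 3 :=
    hsum.sum_le_tsum _ fun _ _ => by positivity
  rw [hzeta, Complex.ofReal_re]
  norm_num [sum_range_succ] at hpartial ⊢
  linarith

theorem two_add_two_mul_sq_mul_sq_le {l t : ℝ} (hl : 0 ≤ l) (ht : 1 ≤ t) :
    2 + 2 * (1 + l) ^ 2 * t ^ 2 ≤
      t * (4 + l) ^ 4 * (5 / 12 + ((riemannZeta 3).re - 1) * t) / 12 := by
  have hquad : 12 * (1 + l) ≤ (4 + l) ^ 2 := by linarith [sq_nonneg (l - 2)]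
  have hquart : 144 * (1 + l) ^ 2 ≤ (4 + l) ^ 4 :=
    calc 144 * (1 + l) ^ 2 = (12 * (1 + l)) ^ 2 := by ring
      _ ≤ ((4 + l) ^ 2) ^ 2 := by gcongr
      _ = (4 + l) ^ 4 := by ring
  have hone : 1 ≤ t * (1 + l) ^ 2 :=
    one_le_mul_of_one_le_of_one_le ht (one_le_pow₀ (by linarith))
  calc 2 + 2 * (1 + l) ^ 2 * t ^ 2
      ≤ t * (144 * (1 + l) ^ 2) * (5 / 12 + 1 / 6 * t) / 12 := by linarith
    _ ≤ t * (4 + l) ^ 4 * (5 / 12 + ((riemannZeta 3).re - 1) * t) / 12 := by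
        gcongr
        exact one_sixth_le_zeta_three_sub_one

theorem add_le_sq_mul_constC {x L₁ L M : ℝ} (hx : 0 < x) (hL₁ : 1 ≤ L₁) (hL : 1 ≤ L)
    (hM : 2 * L < M) :
    x ^ 2 * (2 / M) + (x * (L ^ 2 / 2 * (1 + log L₁)) +
        x ^ 2 * (2 / (M - 2 * L) * (1 + log L₁) ^ 2 * (1 + log L) ^ 2)) ≤
      x ^ 2 * constC x L₁ L M := by
  have hN : 0 < M - 2 * L := sub_pos.mpr hM
  have hl : 0 ≤ log L₁ := log_nonneg hL₁
  have hfirst : x * (L ^ 2 / 2 * (1 + log L₁)) = x ^ 2 * (L ^ 2 / (2 * x) * (1 + log L₁)) := by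
    field_simp
  have hsecond : 0 ≤ 2 * (1 + log L₁) ^ 2 / (M * log M) := by
    have : 0 ≤ log M := log_nonneg (by linarith)
    have : 0 ≤ M := by linarith
    positivity
  have hthird : 2 / M + 2 / (M - 2 * L) * (1 + log L₁) ^ 2 * (1 + log L) ^ 2 ≤
      1 / (12 * (M - 2 * L)) * (1 + log L) * (4 + log L₁) ^ 4 *
        (5 / 12 + ((riemannZeta 3).re - 1) * (1 + log L)) :=
    calc _ ≤ 2 / (M - 2 * L) + 2 / (M - 2 * L) * (1 + log L₁) ^ 2 * (1 + log L) ^ 2 := by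
          gcongr
          linarith
      _ = (2 + 2 * (1 + log L₁) ^ 2 * (1 + log L) ^ 2) / (M - 2 * L) := by ring
      _ ≤ (1 + log L) * (4 + log L₁) ^ 4 *
          (5 / 12 + ((riemannZeta 3).re - 1) * (1 + log L)) / 12 / (M - 2 * L) := by
          gcongr
          exact two_add_two_mul_sq_mul_sq_le hl (le_add_of_nonneg_right (log_nonneg hL))
      _ = _ := by field_simp
  rw [hfirst, add_left_comm, ← mul_add, ← mul_add, constC]
  gcongr
  linarith

theorem mainTheorem8_general {x L₁ L M : ℝ} (hx : 0 < x) (hL₁ : 1 ≤ L₁) (hL : 1 ≤ L)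
    (hM : 2 * L < M) (s : Finset ℕ)
    (hs : ∀ n ∈ s, n ≠ 0 ∧ (n : ℝ) ≤ x ∧ (n.totient : ℝ) / L₁ ≤ fermatCount n ∧
      ∃ p q : ℕ, p.Prime ∧ q.Prime ∧ q ≤ p ∧ (p : ℝ) ≤ L ∧ M < (p : ℝ) * q ∧ p * q ∣ n) :
    ∑ n ∈ s, (fermatCount n : ℝ) ≤ x ^ 2 * constC x L₁ L M := by
  classical
  rw [← sum_filter_add_sum_filter_not s fun n => ∃ p : ℕ, p.Prime ∧ M < (p : ℝ) ^ 2 ∧ p ^ 2 ∣ n]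
  refine (add_le_add ?square ?distinct).trans (add_le_sq_mul_constC hx hL₁ hL hM)
  case square =>
    refine sum_fermatCount_of_prime_sq_dvd_le hx.le (by linarith) fun n hn => ?_
    obtain ⟨hns, hsq⟩ := mem_filter.mp hn
    exact ⟨(hs n hns).1, (hs n hns).2.1, hsq⟩
  case distinct =>
    refine sum_fermatCount_of_primes_mul_dvd_le hx.le hL₁ hL hM fun n hn => ?_
    obtain ⟨hns, hsq⟩ := mem_filter.mp hn
    obtain ⟨hn₀, hnx, hF, p, q, hp, hq, hqp, hpL, hMpq, hdvd⟩ := hs n hns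
    have hne : q ≠ p := by
      rintro rfl
      exact hsq ⟨q, hp, by rwa [sq], by rwa [sq]⟩
    exact ⟨hn₀, hnx, hF, p, q, hp, hq, hqp.lt_of_ne hne, hpL, hMpq, hdvd⟩

/-! ### The two largest prime factors -/

theorem largestPrimeFactor_mem {n : ℕ} (hn : 1 < n) : largestPrimeFactor n ∈ n.primeFactors := by
  obtain ⟨p, hp, h⟩ := exists_mem_eq_sup n.primeFactors (Nat.nonempty_primeFactors.mpr hn) id
  rw [largestPrimeFactor, h]
  exact hp

theorem secondPrimeFactor_mem {n : ℕ} (hn : 1 < n) (hc : ¬ n.Prime) :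
    secondPrimeFactor n ∈ (n / largestPrimeFactor n).primeFactors := by
  obtain ⟨hP, hPn, hn₀⟩ := Nat.mem_primeFactors.mp (largestPrimeFactor_mem hn)
  refine largestPrimeFactor_mem (Nat.one_lt_iff_ne_zero_and_ne_one.mpr ⟨?_, fun h => hc ?_⟩)
  · exact (Nat.div_pos (Nat.le_of_dvd (Nat.pos_of_ne_zero hn₀) hPn) hP.pos).ne'
  · rwa [Nat.eq_of_dvd_of_div_eq_one hPn h] at hP

theorem secondPrimeFactor_le_largestPrimeFactor {n : ℕ} (hn : 1 < n) (hc : ¬ n.Prime) :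
    secondPrimeFactor n ≤ largestPrimeFactor n := by
  have hdvd := Nat.div_dvd_of_dvd (Nat.dvd_of_mem_primeFactors (largestPrimeFactor_mem hn))
  exact le_sup (f := id)
    (Nat.primeFactors_mono hdvd (Nat.ne_zero_of_lt hn) (secondPrimeFactor_mem hn hc))

theorem largestPrimeFactor_mul_secondPrimeFactor_dvd {n : ℕ} (hn : 1 < n) (hc : ¬ n.Prime) :
    largestPrimeFactor n * secondPrimeFactor n ∣ n :=
  (mul_dvd_mul_left _ (Nat.dvd_of_mem_primeFactors (secondPrimeFactor_mem hn hc))).trans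
    (Nat.mul_div_cancel' (Nat.dvd_of_mem_primeFactors (largestPrimeFactor_mem hn))).dvd

theorem exists_primes_of_mem_smoothNearCarmichael {x L₁ L M : ℝ} {n : ℕ}
    (hn : n ∈ smoothNearCarmichael x L₁ L M) :
    n ≠ 0 ∧ (n : ℝ) ≤ x ∧ (n.totient : ℝ) / L₁ ≤ fermatCount n ∧
      ∃ p q : ℕ, p.Prime ∧ q.Prime ∧ q ≤ p ∧ (p : ℝ) ≤ L ∧ M < (p : ℝ) * q ∧ p * q ∣ n := by
  obtain ⟨hnx, -, hn₁, hc, hPL, hMPQ, hF⟩ := mem_filter.mp hn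
  have hn₀ : n ≠ 0 := Nat.ne_zero_of_lt hn₁
  exact ⟨hn₀, (Nat.le_floor_iff' hn₀).mp (mem_Icc.mp hnx).2, hF,
    largestPrimeFactor n, secondPrimeFactor n,
    Nat.prime_of_mem_primeFactors (largestPrimeFactor_mem hn₁),
    Nat.prime_of_mem_primeFactors (secondPrimeFactor_mem hn₁ hc),
    secondPrimeFactor_le_largestPrimeFactor hn₁ hc, hPL, hMPQ,
    largestPrimeFactor_mul_secondPrimeFactor_dvd hn₁ hc⟩

theorem mainTheorem8 (x L₁ L M : ℝ) (hL₁ : 10 < L₁) (hL : L₁ < L) (hLM : L < M / 2)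
    (hML : M < L ^ 2) (hx : L ^ 2 < x) :
    ∑ n ∈ smoothNearCarmichael x L₁ L M, (fermatCount n : ℝ) ≤ x ^ 2 * constC x L₁ L M :=
  mainTheorem8_general ((sq_nonneg L).trans_lt hx) (by linarith) (by linarith) (by linarith) _
    fun _ => exists_primes_of_mem_smoothNearCarmichael
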